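/- Let $G$ be a finite group with identity $1$. For a finite group $H$ and a generating set $A$ of $H$, let $l_A(h)$ be the least length of a (possibly empty) sequence of elements of $A$ (inverses not allowed) whose product is $h$; let $\mathrm{diam}(H,A)=\max_{h\in H} l_A(h)$, and let $D(H)$ be the maximum of $\mathrm{diam}(H,A)$ over all generating sets $A$ of $H$. Let $\mathrm{rank}(H)$ denote the minimum size of a generating set of $H$, let $G'$ be the commutator subgroup of $G$, let $G^n$ be the $n$-th direct power of $G$, and put $\alpha=\mathrm{rank}(G)$, $\beta=\mathrm{rank}(G/G')$. (1) Suppose that $G$ is solvable of derived length $l$ (the least $l$ with $G^{(l)}=1$). Let $n$ be a natural number with $n\ge \alpha/\beta$ (if $G$ is trivial, so that $\alpha=\beta=0$, this condition is regarded as satisfied by every $n$), and let $A$ be a generating set of $G^n$ of minimum size. Then $$\mathrm{diam}(G^n,A)\le 2\,(4^{\,l-1}n^l|G|+1)(n\beta+1)\,n\ln|G|.$$ (2) If $G$ is a $p$-group for some prime $p$, of derived length $l$, then for all $n\ge 1$ $$D(G^n)\le 2\,(4^{\,l-1}n^l|G|+1)(n\beta+1)\,n\ln|G|.$$ -/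

import Mathlib

/-- The length of `g` with respect to `A`: the least length of a (possibly empty) sequence of
elements of `A` with product `g`. No inverses of elements of `A` are allowed. (If `A` generates a
finite group, every `g` has such a sequence.) -/
noncomputable def wordLength {H : Type*} [Group H] (A : Set H) (g : H) : ℕ :=
  sInf {k : ℕ | ∃ w : List H, (∀ a ∈ w, a ∈ A) ∧ w.prod = g ∧ w.length = k}

/-- `A` generates the group `H`. -/
def IsGeneratingSet {H : Type*} [Group H] (A : Set H) : Prop :=
  Subgroup.closure A = ⊤

/-- `A` is a generating set of the finite group `H` of minimum size. -/
def IsMinimumSizeGeneratingSet {H : Type*} [Group H] [Finite H] (A : Set H) : Prop :=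
  IsGeneratingSet A ∧ ∀ B : Set H, IsGeneratingSet B → A.ncard ≤ B.ncard

/-- The (directed) diameter `diam(H, A)` of a finite group with respect to `A`: the maximum of the
lengths of the elements of `H`. -/
noncomputable def groupDiam {H : Type*} [Group H] [Finite H] (A : Set H) : ℕ :=
  ⨆ g : H, wordLength A g

/-- `D(H)`: the maximum diameter of the finite group `H` over all its generating sets. -/
noncomputable def maxGroupDiam (H : Type*) [Group H] [Finite H] : ℕ :=
  ⨆ A : {A : Set H // IsGeneratingSet A}, groupDiam A.1

/-- The derived length of a (solvable) group: the least `l` for which the `l`-th term of the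
derived series is trivial. -/
noncomputable def groupDerivedLength (G : Type*) [Group G] : ℕ :=
  sInf {l : ℕ | derivedSeries G l = ⊥}

open scoped Pointwise

/-! One bound on all generating sets of `G^n` gives both parts: `2d + 1 ≤ (2n)^l |G|`. The quantity
`2d + 1` is submultiplicative in extensions, by the directed Schreier argument
`DiameterLE.extension`. Apply this to `G'^n → G^n → (G/G')^n` and induct on derived length;
`diameterLE_pi_comm` bounds the abelian quotient by `n(|G/G'| - 1)`. The stated bound is weaker. -/

/-- Every element of `H` is a product of at most `d` elements of any generating set of `H`. -/
def DiameterLE (H : Type*) [Group H] (d : ℕ) : Prop :=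
  ∀ A : Set H, Subgroup.closure A = ⊤ → (insert 1 A) ^ d = Set.univ

/-! ### Word lengths and uniform diameter bounds -/

theorem exists_list_of_mem_insert_one_pow {H : Type*} [Group H] {A : Set H} {d : ℕ} {g : H}
    (hg : g ∈ (insert 1 A) ^ d) :
    ∃ w : List H, (∀ a ∈ w, a ∈ A) ∧ w.prod = g ∧ w.length ≤ d := by
  induction d generalizing g with
  | zero =>
    rw [pow_zero, Set.mem_one] at hg
    exact ⟨[], by simp, by simp [hg], by simp⟩
  | succ d ih =>
    rw [pow_succ'] at hg
    obtain ⟨a, ha, b, hb, rfl⟩ := Set.mem_mul.1 hg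
    obtain ⟨w, hw, rfl, hl⟩ := ih hb
    rcases ha with rfl | ha
    · exact ⟨w, hw, by simp, by omega⟩
    · exact ⟨a :: w, by simpa using ⟨ha, hw⟩, by simp, by simpa using hl⟩

theorem DiameterLE.wordLength_le {H : Type*} [Group H] {d : ℕ} (hd : DiameterLE H d)
    {A : Set H} (hA : IsGeneratingSet A) (g : H) : wordLength A g ≤ d := by
  have hg : g ∈ (insert 1 A) ^ d := by rw [hd A hA]; trivial
  obtain ⟨w, hw, hp, hl⟩ := exists_list_of_mem_insert_one_pow hg
  exact (Nat.sInf_le (show w.length ∈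
    {k : ℕ | ∃ w : List H, (∀ a ∈ w, a ∈ A) ∧ w.prod = g ∧ w.length = k} from ⟨w, hw, hp, rfl⟩)).trans hl

theorem DiameterLE.groupDiam_le {H : Type*} [Group H] [Finite H] {d : ℕ} (hd : DiameterLE H d)
    {A : Set H} (hA : IsGeneratingSet A) : groupDiam A ≤ d :=
  ciSup_le fun g => hd.wordLength_le hA g

theorem DiameterLE.maxGroupDiam_le {H : Type*} [Group H] [Finite H] {d : ℕ}
    (hd : DiameterLE H d) : maxGroupDiam H ≤ d := by
  have : Nonempty {A : Set H // IsGeneratingSet A} := ⟨⟨Set.univ, Subgroup.closure_univ⟩⟩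
  exact ciSup_le fun A => hd.groupDiam_le A.2

theorem diameterLE_zero (H : Type*) [Group H] [Subsingleton H] : DiameterLE H 0 := by
  intro A _
  ext g
  simpa using Subsingleton.elim g 1

/-! ### Extensions -/

theorem closure_image_eq_top {H Q : Type*} [Group H] [Group Q] (f : H →* Q)
    (hf : Function.Surjective f) {A : Set H} (hA : Subgroup.closure A = ⊤) :
    Subgroup.closure (f '' A) = ⊤ := by
  rw [← MonoidHom.map_closure, hA, ← MonoidHom.range_eq_map, MonoidHom.range_eq_top.2 hf]

theorem image_insert_one_pow {H Q : Type*} [Group H] [Group Q] (f : H →* Q) (A : Set H)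
    (d : ℕ) : f '' (insert 1 A) ^ d = (insert 1 (f '' A)) ^ d := by
  rw [Set.image_pow, Set.image_insert_eq, map_one]

/-- A directed form of Schreier's lemma, with lengths. -/
theorem DiameterLE.extension {H Q K : Type*} [Group H] [Group Q] [Group K]
    (f : H →* Q) (hf : Function.Surjective f) (i : K →* H) (hi : Function.Injective i)
    (hfi : i.range = f.ker) {d m : ℕ} (hd : DiameterLE Q d) (hm : DiameterLE K m) :
    DiameterLE H (d + (2 * d + 1) * m) := by
  intro A hA
  set S : Set H := insert 1 A with hS
  have h1S : (1 : H) ∈ S := Set.mem_insert _ _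
  have hex : ∀ q : Q, ∃ t ∈ S ^ d, f t = q := by
    intro q
    have : q ∈ f '' S ^ d := by
      rw [image_insert_one_pow, hd _ (closure_image_eq_top f hf hA)]; trivial
    exact this
  choose t htS hft using hex
  set X : Set K := {k | i k ∈ S ^ (2 * d + 1)} with hX
  have hker : ∀ h : H, f h = 1 → ∃ k, i k = h := by
    intro h hh
    have : h ∈ i.range := by rw [hfi]; exact hh
    exact this
  have hword : ∀ h ∈ S ^ (2 * d + 1), f h = 1 → ∃ x ∈ Subgroup.closure X, i x = h := by
    intro h hh h1
    obtain ⟨k, rfl⟩ := hker h h1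
    exact ⟨k, Subgroup.subset_closure hh, rfl⟩
  -- The inverse of `t q'` need not be a short positive word, so `t q'⁻¹` replaces it. The Schreier
  -- generator is then a quotient of two kernel words of length at most `2d + 1`.
  have hstep : ∀ (q : Q) (a : H), a ∈ A →
      ∃ x ∈ Subgroup.closure X, i x = t q * a * (t (q * f a))⁻¹ := by
    intro q a ha
    set q' := q * f a with hq'
    obtain ⟨x, hx, hx'⟩ := hword (t q * a * t q'⁻¹) (by
      have h2 : 2 * d + 1 = d + 1 + d := by ring
      rw [h2, pow_add, pow_succ]
      exact Set.mul_mem_mul (Set.mul_mem_mul (htS _) (Set.mem_insert_of_mem _ ha)) (htS _))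
      (by simp [hft, hq'])
    obtain ⟨y, hy, hy'⟩ := hword (t q' * t q'⁻¹) (by
      refine Set.pow_subset_pow_right h1S (show d + d ≤ 2 * d + 1 by omega) ?_
      rw [pow_add]
      exact Set.mul_mem_mul (htS _) (htS _))
      (by simp [hft])
    refine ⟨x * y⁻¹, mul_mem hx (inv_mem hy), ?_⟩
    rw [map_mul, map_inv, hx', hy']
    group
  have hall : ∀ h : H, ∃ x ∈ Subgroup.closure X, i x = h * (t (f h))⁻¹ := by
    intro h
    have hh : h ∈ Subgroup.closure A := by rw [hA]; trivial
    induction hh using Subgroup.closure_induction_right with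
    | one =>
      obtain ⟨x, hx, hx'⟩ := hword (t 1)
        (Set.pow_subset_pow_right h1S (show d ≤ 2 * d + 1 by omega) (htS 1)) (hft 1)
      exact ⟨x⁻¹, inv_mem hx, by simp [hx']⟩
    | mul_right h _ a ha ih =>
      obtain ⟨x, hx, hx'⟩ := ih
      obtain ⟨y, hy, hy'⟩ := hstep (f h) a ha
      refine ⟨x * y, mul_mem hx hy, ?_⟩
      rw [map_mul, hx', hy', map_mul]
      group
    | mul_inv_cancel h _ a ha ih =>
      obtain ⟨x, hx, hx'⟩ := ih
      obtain ⟨y, hy, hy'⟩ := hstep (f (h * a⁻¹)) a ha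
      refine ⟨x * y⁻¹, mul_mem hx (inv_mem hy), ?_⟩
      rw [← map_mul, inv_mul_cancel_right] at hy'
      rw [map_mul, map_inv, hx', hy']
      group
  have htop : ∀ k : K, k ∈ Subgroup.closure X := by
    intro k
    obtain ⟨x, hx, hx'⟩ := hall (i k)
    -- `t 1` need not be `1`; `y` cancels it.
    obtain ⟨y, hy, hy'⟩ := hall 1
    have hk : f (i k) = 1 := by
      have : i k ∈ f.ker := by rw [← hfi]; exact ⟨k, rfl⟩
      exact this
    have : k = x * y⁻¹ := by
      apply hi
      rw [map_mul, map_inv, hx', hy', hk, map_one]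
      group
    rw [this]
    exact mul_mem hx (inv_mem hy)
  have hXtop : Subgroup.closure X = ⊤ :=
    (Subgroup.eq_top_iff' _).2 htop
  have hX1 : insert 1 X = X := Set.insert_eq_of_mem (by
    rw [hX, Set.mem_ofPred_eq, map_one]
    exact Set.one_mem_pow h1S)
  rw [Set.eq_univ_iff_forall]
  intro h
  obtain ⟨k, hk⟩ := hker (h * (t (f h))⁻¹) (by simp [hft])
  have hkX : k ∈ X ^ m := by rw [← hX1, hm X hXtop]; trivial
  have hkS : i k ∈ S ^ ((2 * d + 1) * m) := by
    rw [pow_mul]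
    have : i k ∈ i '' X ^ m := ⟨k, hkX, rfl⟩
    rw [Set.image_pow] at this
    refine Set.pow_subset_pow_left ?_ this
    rintro _ ⟨x, hx, rfl⟩
    exact hx
  have : h = i k * t (f h) := by rw [hk]; group
  rw [this, add_comm, pow_add]
  exact Set.mul_mem_mul hkS (htS _)

/-! ### Abelian groups of bounded exponent -/

theorem sub_one_mul_log_le {m b : ℝ} (hm : 1 ≤ m) (hmb : m ≤ b) :
    (m - 1) * Real.log b ≤ (b - 1) * Real.log m := by
  rcases hm.eq_or_lt with rfl | hm
  · simp
  rcases hmb.eq_or_lt with rfl | hmb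
  · simp
  -- Concavity of `log`, with `m` written as a convex combination of `1` and `b`.
  have h := strictConcaveOn_log_Ioi.concaveOn.2 (show (1 : ℝ) ∈ Set.Ioi 0 by simp)
    (show b ∈ Set.Ioi 0 from show 0 < b by linarith)
    (show 0 ≤ (b - m) / (b - 1) from div_nonneg (by linarith) (by linarith))
    (show 0 ≤ (m - 1) / (b - 1) from div_nonneg (by linarith) (by linarith))
    (by have : b - 1 ≠ 0 := by linarith
        field_simp; ring)
  have hb : b - 1 ≠ 0 := by linarith
  have hb' : 0 < b - 1 := by linarith
  have e : (b - m) / (b - 1) * 1 + (m - 1) / (b - 1) * b = m := by field_simp; ring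
  simp only [smul_eq_mul, e, Real.log_one, mul_zero, zero_add] at h
  rw [div_mul_eq_mul_div, div_le_iff₀ hb'] at h
  linarith

/-- Factoring out `⟨a⟩` for a nontrivial generator `a` costs `orderOf a - 1` letters. These orders
multiply to `|Q|` and each is at most `b`, so `sub_one_mul_log_le` bounds the total cost. -/
theorem exists_insert_one_pow_eq_univ_of_comm {Q : Type*} [CommGroup Q] [Finite Q] {b : ℕ}
    (hb : 0 < b) (hexp : ∀ q : Q, q ^ b = 1) {A : Set Q} (hA : Subgroup.closure A = ⊤) :
    ∃ k : ℕ, (k : ℝ) * Real.log b ≤ ((b : ℝ) - 1) * Real.log (Nat.card Q) ∧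
      (insert 1 A) ^ k = Set.univ := by
  induction hc : Nat.card Q using Nat.strong_induction_on generalizing Q with
  | _ c ih =>
    by_cases hA1 : ∀ a ∈ A, a = 1
    · have hbot : Subgroup.closure A = ⊥ := (Subgroup.closure_eq_bot_iff).2 hA1
      have hs : Subsingleton Q := Subgroup.subsingleton_iff.1
        (subsingleton_of_bot_eq_top (hbot.symm.trans hA))
      refine ⟨0, ?_, diameterLE_zero Q A hA⟩
      rw [← hc, Nat.card_unique]
      simp
    push Not at hA1
    obtain ⟨a, ha, ha1⟩ := hA1
    have hm : Nat.card Q = Nat.card (Q ⧸ Subgroup.zpowers a) * orderOf a := by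
      rw [Subgroup.card_eq_card_quotient_mul_card_subgroup (Subgroup.zpowers a), Nat.card_zpowers]
    have hmpos : 0 < orderOf a := orderOf_pos a
    have hm1 : orderOf a ≠ 1 := by rwa [Ne, orderOf_eq_one_iff]
    have hqpos : 0 < Nat.card (Q ⧸ Subgroup.zpowers a) := Nat.card_pos
    have hmb : orderOf a ≤ b := Nat.le_of_dvd hb (orderOf_dvd_of_pow_eq_one (hexp a))
    obtain ⟨k, hk, hk'⟩ := ih (Nat.card (Q ⧸ Subgroup.zpowers a)) (by
        rw [← hc, hm]; exact lt_mul_of_one_lt_right hqpos (by omega))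
      (Q := Q ⧸ Subgroup.zpowers a)
      (fun q => by
        obtain ⟨q, rfl⟩ := QuotientGroup.mk_surjective q
        rw [← QuotientGroup.mk_pow, hexp, QuotientGroup.mk_one])
      (closure_image_eq_top (QuotientGroup.mk' _) (QuotientGroup.mk'_surjective _) hA) rfl
    refine ⟨k + (orderOf a - 1), ?_, ?_⟩
    · have hlog := sub_one_mul_log_le (m := orderOf a) (b := b)
        (by exact_mod_cast hmpos) (by exact_mod_cast hmb)
      rw [← hc, hm]
      push_cast [Nat.cast_sub hmpos]
      rw [Real.log_mul (by positivity) (by positivity)]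
      linarith
    · rw [Set.eq_univ_iff_forall]
      intro q
      have hq : QuotientGroup.mk' (Subgroup.zpowers a) q ∈
          QuotientGroup.mk' (Subgroup.zpowers a) '' (insert 1 A) ^ k := by
        rw [image_insert_one_pow, hk']; trivial
      obtain ⟨s, hs, hsq⟩ := hq
      have hz : s⁻¹ * q ∈ Subgroup.zpowers a := QuotientGroup.eq.1 hsq
      classical
      obtain ⟨j, hj, hja⟩ := Finset.mem_image.1 (mem_zpowers_iff_mem_range_orderOf.1 hz)
      rw [Finset.mem_range] at hj
      have hq : q = s * a ^ j := by rw [hja, mul_inv_cancel_left]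
      rw [hq, pow_add]
      refine Set.mul_mem_mul hs (Set.pow_subset_pow_right (Set.mem_insert _ _)
        (show j ≤ orderOf a - 1 by omega) (Set.pow_mem_pow (Set.mem_insert_of_mem _ ha)))

theorem diameterLE_pi_comm {B : Type*} [CommGroup B] [Finite B] (n : ℕ) :
    DiameterLE (Fin n → B) (n * (Nat.card B - 1)) := by
  intro A hA
  have hb : 0 < Nat.card B := Nat.card_pos
  rcases (show 1 ≤ Nat.card B from hb).eq_or_lt with h1 | h1
  · have : Subsingleton B := (Nat.card_eq_one_iff_unique.1 h1.symm).1
    rw [← h1]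
    exact diameterLE_zero _ A hA
  obtain ⟨k, hk, hk'⟩ := exists_insert_one_pow_eq_univ_of_comm hb
    (fun q : Fin n → B => by ext j; simp) hA
  have hlog : 0 < Real.log (Nat.card B) := Real.log_pos (by exact_mod_cast h1)
  have hkn : k ≤ n * (Nat.card B - 1) := by
    rw [Nat.card_fun, Nat.card_fin, Nat.cast_pow, Real.log_pow, ← mul_assoc] at hk
    have := le_of_mul_le_mul_right hk hlog
    have h2 : (k : ℝ) ≤ ((n * (Nat.card B - 1) : ℕ) : ℝ) := by
      push_cast [Nat.cast_sub hb]; linarith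
    exact_mod_cast h2
  rw [← Set.univ_subset_iff, ← hk']
  exact Set.pow_subset_pow_right (Set.mem_insert _ _) hkn

/-! ### Induction on derived length and the final estimate -/

theorem map_derivedSeries_commutator (G : Type*) [Group G] (l : ℕ) :
    (derivedSeries (commutator G) l).map (commutator G).subtype = derivedSeries G (l + 1) := by
  induction l with
  | zero => rw [derivedSeries_zero, ← MonoidHom.range_eq_map, Subgroup.range_subtype, zero_add,
      derivedSeries_one]
  | succ l ih => rw [derivedSeries_succ, Subgroup.map_commutator, ih, ← derivedSeries_succ]

theorem exists_diameterLE_pi {G : Type*} [Group G] [Finite G] {n : ℕ} (hn : 0 < n) {l : ℕ}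
    (hl : derivedSeries G l = ⊥) :
    ∃ d : ℕ, 2 * d + 1 ≤ (2 * n) ^ l * Nat.card G ∧ DiameterLE (Fin n → G) d := by
  induction l generalizing G with
  | zero =>
    have : Subsingleton G := Subgroup.subsingleton_iff.1
      (subsingleton_of_bot_eq_top (hl.symm.trans (derivedSeries_zero G)))
    exact ⟨0, by simp, diameterLE_zero _⟩
  | succ l ih =>
    obtain ⟨m, hm, hm'⟩ := ih (G := commutator G) (by
      rw [← map_derivedSeries_commutator] at hl
      exact (Subgroup.map_eq_bot_iff_of_injective _ (Subgroup.subtype_injective _)).1 hl)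
    have hQ : DiameterLE (Fin n → Abelianization G) _ := diameterLE_pi_comm n
    refine ⟨_, ?_, hQ.extension
      (MonoidHom.pi fun j => Abelianization.of.comp (Pi.evalMonoidHom _ j)) ?_
      (MonoidHom.pi fun j => (commutator G).subtype.comp (Pi.evalMonoidHom _ j)) ?_ ?_ hm'⟩
    · have hcard : Nat.card G = Nat.card (Abelianization G) * Nat.card (commutator G) :=
        Subgroup.card_eq_card_quotient_mul_card_subgroup _
      obtain ⟨b, hb⟩ : ∃ b, Nat.card (Abelianization G) = b + 1 :=
        Nat.exists_eq_succ_of_ne_zero Nat.card_pos.ne'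
      rw [hcard, hb, Nat.add_sub_cancel]
      calc 2 * (n * b + (2 * (n * b) + 1) * m) + 1 = (2 * (n * b) + 1) * (2 * m + 1) := by ring
        _ ≤ (2 * n * (b + 1)) * ((2 * n) ^ l * Nat.card (commutator G)) :=
          -- `2nb + 1 ≤ 2n(b + 1)` because `n ≥ 1`.
          Nat.mul_le_mul (by nlinarith) hm
        _ = _ := by ring
    · intro q
      choose g hg using fun j => QuotientGroup.mk_surjective (q j)
      exact ⟨g, funext hg⟩
    · intro x y hxy
      ext j
      exact congrFun hxy j
    · ext h
      constructor
      · rintro ⟨k, rfl⟩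
        funext j
        exact (QuotientGroup.eq_one_iff _).2 (k j).2
      · intro hh
        exact ⟨fun j => ⟨h j, (QuotientGroup.eq_one_iff _).1 (congrFun hh j)⟩, rfl⟩

theorem derivedSeries_groupDerivedLength (G : Type*) [Group G] (h : Group.IsSolvable G) :
    derivedSeries G (groupDerivedLength G) = ⊥ :=
  Nat.sInf_mem (s := {l : ℕ | derivedSeries G l = ⊥}) ((Group.isSolvable_def G).1 h)

theorem exists_diameterLE_pi_of_isSolvable {G : Type*} [Group G] [Finite G]
    (h : Group.IsSolvable G) (n β : ℕ) :
    ∃ d : ℕ, DiameterLE (Fin n → G) d ∧ (d : ℝ) ≤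
      2 * ((4 : ℝ) ^ ((groupDerivedLength G : ℤ) - 1) * (n : ℝ) ^ groupDerivedLength G
          * (Nat.card G : ℝ) + 1) * ((n : ℝ) * (β : ℝ) + 1) * (n : ℝ)
        * Real.log (Nat.card G : ℝ) := by
  have hcard : 1 ≤ Nat.card G := Nat.card_pos
  rcases Nat.eq_zero_or_pos n with rfl | hn
  · exact ⟨0, diameterLE_zero _, by simp⟩
  -- For trivial `G` the exponent `l - 1` is `-1`, harmless since `log 1 = 0`.
  rcases hcard.eq_or_lt with h1 | h1
  · have : Subsingleton G := (Nat.card_eq_one_iff_unique.1 h1.symm).1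
    exact ⟨0, diameterLE_zero _, by simp⟩
  obtain ⟨d, hd, hd'⟩ := exists_diameterLE_pi hn (derivedSeries_groupDerivedLength G h)
  refine ⟨d, hd', ?_⟩
  obtain ⟨l, hl⟩ : ∃ l, groupDerivedLength G = l + 1 := by
    refine Nat.exists_eq_succ_of_ne_zero fun h0 => ?_
    have hbot := derivedSeries_groupDerivedLength G h
    rw [h0, derivedSeries_zero] at hbot
    have : Subsingleton G :=
      Subgroup.subsingleton_iff.1 (subsingleton_of_bot_eq_top hbot.symm)
    rw [Nat.card_unique] at h1
    omega
  rw [hl] at hd ⊢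
  have hpow : (4 : ℝ) ^ (((l + 1 : ℕ) : ℤ) - 1) = 4 ^ l := by
    rw [Nat.cast_succ, add_sub_cancel_right, zpow_natCast]
  rw [hpow]
  have hn1 : (1 : ℝ) ≤ n := by exact_mod_cast hn
  have hdR : 2 * (d : ℝ) + 1 ≤ (2 * n) ^ (l + 1) * Nat.card G := by exact_mod_cast hd
  have h24 : (2 : ℝ) ^ l ≤ 4 ^ l := pow_le_pow_left₀ (by norm_num) (by norm_num) l
  have hX : (d : ℝ) ≤ 4 ^ l * (n : ℝ) ^ (l + 1) * Nat.card G := by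
    have : (2 : ℝ) ^ l * ((n : ℝ) ^ (l + 1) * Nat.card G) ≤
        4 ^ l * ((n : ℝ) ^ (l + 1) * Nat.card G) := by gcongr
    rw [mul_pow, pow_succ (2 : ℝ)] at hdR
    linarith
  -- The leading factor `2` absorbs this `1/2`.
  have hlog : 1 / 2 ≤ Real.log (Nat.card G) := by
    have h2 : Real.log 2 ≤ Real.log (Nat.card G) :=
      Real.log_le_log (by norm_num) (by exact_mod_cast h1)
    linarith [Real.log_two_gt_d9]
  have hβ : 1 ≤ (n : ℝ) * β + 1 := by
    have : (0 : ℝ) ≤ n * β := by positivity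
    linarith
  set X : ℝ := 4 ^ l * (n : ℝ) ^ (l + 1) * Nat.card G + 1 with hXdef
  calc (d : ℝ) ≤ 2 * X * 1 * 1 * (1 / 2) := by linarith
    _ ≤ 2 * X * ((n : ℝ) * β + 1) * n * Real.log (Nat.card G) := by
      have : 0 ≤ X := by positivity
      gcongr

theorem mainTheorem9 {G : Type*} [Group G] [Finite G] :
    (Group.IsSolvable G →
      ∀ (n : ℕ), (Group.rank G : ℝ) / (Group.rank (G ⧸ commutator G) : ℝ) ≤ (n : ℝ) →
      ∀ (A : Set (Fin n → G)), IsMinimumSizeGeneratingSet A →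
        (groupDiam A : ℝ) ≤
          2 * ((4 : ℝ) ^ ((groupDerivedLength G : ℤ) - 1) * (n : ℝ) ^ groupDerivedLength G
              * (Nat.card G : ℝ) + 1)
            * ((n : ℝ) * (Group.rank (G ⧸ commutator G) : ℝ) + 1)
            * (n : ℝ) * Real.log (Nat.card G : ℝ)) ∧
    (∀ p : ℕ, p.Prime → IsPGroup p G →
      ∀ (n : ℕ), 1 ≤ n →
        (maxGroupDiam (Fin n → G) : ℝ) ≤
          2 * ((4 : ℝ) ^ ((groupDerivedLength G : ℤ) - 1) * (n : ℝ) ^ groupDerivedLength G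
              * (Nat.card G : ℝ) + 1)
            * ((n : ℝ) * (Group.rank (G ⧸ commutator G) : ℝ) + 1)
            * (n : ℝ) * Real.log (Nat.card G : ℝ)) := by
  refine ⟨fun h n _ A hA => ?_, fun p hp hG n _ => ?_⟩
  · obtain ⟨d, hd, hle⟩ := exists_diameterLE_pi_of_isSolvable h n (Group.rank (G ⧸ commutator G))
    exact (Nat.cast_le.2 (hd.groupDiam_le hA.1)).trans hle
  · have : Fact p.Prime := ⟨hp⟩
    have := hG.isNilpotent
    obtain ⟨d, hd, hle⟩ := exists_diameterLE_pi_of_isSolvable (G := G) inferInstance n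
      (Group.rank (G ⧸ commutator G))
    exact (Nat.cast_le.2 hd.maxGroupDiam_le).trans hle
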